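/- Let $M$ be a smooth real supermanifold of dimension $(p|q)$ with structure sheaf $\mathscr{C}^\infty_M$, and use the Cartan calculus with Deligne's sign convention: $d$ has form degree $1$ and is even, $i_X$ has form degree $-1$ and the parity of $X$, $i_{fX}=f\,i_X$, and $i_X i_Y=-(-1)^{|X||Y|}i_Y i_X$ for $X,Y$ of parities $|X|,|Y|$. Let $\alpha$ be a differential $k$-form on $M$, $k\ge 0$ (not necessarily of definite parity), and for every open $U$ in the body of $M$ let $$\chi(\alpha)(U)=\{X \text{ a vector field on } U:\ i_X\alpha=0 \text{ and } i_X d\alpha=0\},$$ that is, $\chi(\alpha)=\ker\alpha\cap\ker d\alpha$ (with $i_X=0$ on $0$-forms). Suppose that $\alpha$ is regular, i.e. that for some $r$, $\chi(\alpha)$ is a distribution of rank $r$: a vector subbundle of $\mathsf{T}M$ of total rank $r$, which means that near every point of the body there is a local frame of $\mathsf{T}M$ consisting of homogeneous (even or odd) vector fields such that $r$ of them freely generate $\chi(\alpha)$ as a left $\mathscr{C}^\infty_M$-module. Then: 1. $\chi(\alpha)$ is involutive: for every open $U$ and all $X,Y\in\chi(\alpha)(U)$, the super Lie bracket $[X,Y]$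 lies in $\chi(\alpha)(U)$; 2. $\alpha$ is $\chi(\alpha)$-invariant: $\mathcal{L}_X\alpha=0$ on $U$ for every open $U$ and every $X\in\chi(\alpha)(U)$. -/

import Mathlib

open CategoryTheory TopologicalSpace Opposite
open scoped Manifold ContDiff TensorProduct

universe u

noncomputable section

/-- The Koszul sign `(-1)^a` of a parity `a`. -/
def koszulSign (a : ZMod 2) : ℝ := (-1) ^ a.val

/-- Superfunctions on the superdomain of dimension `p|q` with underlying open set `W ⊆ ℝ^p`:
the algebra `C^∞(W) ⊗ Λ(ℝ^q)`. -/
abbrev SuperDomain (p q : ℕ) (W : Opens (EuclideanSpace ℝ (Fin p))) : Type :=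
  C^∞⟮𝓘(ℝ, EuclideanSpace ℝ (Fin p)), W; 𝓘(ℝ, ℝ), ℝ⟯ ⊗[ℝ] ExteriorAlgebra ℝ (Fin q → ℝ)

/-- The open set `φ⁻¹(W)` in the source of a chart `φ`. -/
def chartPreimage {X E : Type*} [TopologicalSpace X] [TopologicalSpace E]
    (φ : OpenPartialHomeomorph X E) (W : Opens E) : Opens X :=
  ⟨φ.source ∩ φ ⁻¹' W, φ.isOpen_inter_preimage W.isOpen⟩

theorem chartPreimage_mono {X E : Type*} [TopologicalSpace X] [TopologicalSpace E]
    (φ : OpenPartialHomeomorph X E) {W' W : Opens E} (h : W' ≤ W) :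
    chartPreimage φ W' ≤ chartPreimage φ W :=
  fun _ hx => ⟨hx.1, h hx.2⟩

/-- A (smooth, real) supermanifold of dimension `p|q`: a second countable Hausdorff space (the body)
with a sheaf of supercommutative `ℝ`-algebras that is locally isomorphic, as a sheaf of
`ℤ/2`-graded algebras, to `C^∞ ⊗ Λ(ℝ^q)` over open subsets of `ℝ^p`. -/
structure Supermanifold (p q : ℕ) where
  /-- The underlying space of the body. -/
  body : TopCat.{u}
  t2 : T2Space body
  secondCountable : SecondCountableTopology body
  /-- The sheaf of superfunctions. -/
  structureSheaf : TopCat.Sheaf (AlgCat.{u} ℝ) body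
  /-- Superfunctions of given parity. -/
  parity : ∀ U : Opens body, ZMod 2 → Submodule ℝ (structureSheaf.presheaf.obj (op U))
  graded : ∀ U, GradedAlgebra (parity U)
  parity_res : ∀ {V U : Opens body} (h : V ≤ U) {a : ZMod 2}
    {f : structureSheaf.presheaf.obj (op U)}, f ∈ parity U a →
      (structureSheaf.presheaf.map (homOfLE h).op).hom f ∈ parity V a
  supercomm : ∀ {U : Opens body} {a b : ZMod 2} {f g : structureSheaf.presheaf.obj (op U)},
    f ∈ parity U a → g ∈ parity U b → f * g = koszulSign (a * b) • (g * f)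
  exists_chart : ∀ x : body, ∃ φ : OpenPartialHomeomorph body (EuclideanSpace ℝ (Fin p)),
    x ∈ φ.source ∧
    ∃ e : ∀ W : Opens (EuclideanSpace ℝ (Fin p)), (W : Set _) ⊆ φ.target →
        (SuperDomain p q W ≃ₐ[ℝ] structureSheaf.presheaf.obj (op (chartPreimage φ W))),
      (∀ W hW g, ∀ a : ZMod 2, ∀ l ∈ CliffordAlgebra.evenOdd (0 : QuadraticForm ℝ (Fin q → ℝ)) a,
        e W hW (g ⊗ₜ[ℝ] l) ∈ parity (chartPreimage φ W) a) ∧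
      (∀ W hW W' hW', ∀ h : W' ≤ W, ∀ g l,
        (structureSheaf.presheaf.map (homOfLE (chartPreimage_mono φ h)).op).hom
            (e W hW (g ⊗ₜ[ℝ] l)) =
          e W' hW' (ContMDiffMap.restrictRingHom 𝓘(ℝ, EuclideanSpace ℝ (Fin p)) 𝓘(ℝ, ℝ) ℝ h g
            ⊗ₜ[ℝ] l))

namespace Supermanifold

attribute [instance] t2 secondCountable graded

variable {p q : ℕ} (M : Supermanifold.{u} p q)

/-- The algebra of superfunctions over an open subset of the body. -/
abbrev Fn (U : Opens M.body) : Type u := M.structureSheaf.presheaf.obj (op U)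

/-- Restriction of superfunctions. -/
def res {V U : Opens M.body} (h : V ≤ U) : M.Fn U →ₐ[ℝ] M.Fn V :=
  (M.structureSheaf.presheaf.map (homOfLE h).op).hom

theorem res_res {W V U : Opens M.body} (h : W ≤ V) (h' : V ≤ U) (f : M.Fn U) :
    M.res h (M.res h' f) = M.res (h.trans h') f := by
  have : (homOfLE (h.trans h')).op = (homOfLE h').op ≫ (homOfLE h).op := rfl
  simp [res, this]

/-- Families of `ℝ`-linear endomorphisms of the spaces of superfunctions over the open subsets
of `U`. -/
abbrev Oper (U : Opens M.body) : Type u := ∀ V : {V // V ≤ U}, Module.End ℝ (M.Fn V.1)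

/-- Homogeneous vector fields of parity `a` on `U`: superderivations of parity `a` of the
structure sheaf over `U`. -/
def homVec (U : Opens M.body) (a : ZMod 2) : Submodule ℝ (M.Oper U) where
  carrier := {D |
    (∀ (V W : {V // V ≤ U}) (h : W.1 ≤ V.1) (f : M.Fn V.1), M.res h (D V f) = D W (M.res h f)) ∧
    (∀ (V : {V // V ≤ U}) (b : ZMod 2) (f : M.Fn V.1), f ∈ M.parity V.1 b →
      D V f ∈ M.parity V.1 (a + b)) ∧
    (∀ (V : {V // V ≤ U}) (b : ZMod 2) (f g : M.Fn V.1), f ∈ M.parity V.1 b →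
      D V (f * g) = D V f * g + koszulSign (a * b) • (f * D V g))}
  add_mem' := by
    rintro D E ⟨h1, h2, h3⟩ ⟨k1, k2, k3⟩
    refine ⟨fun V W h f => ?_, fun V b f hf => ?_, fun V b f g hf => ?_⟩
    · simp [h1 V W h, k1 V W h]
    · exact add_mem (h2 V b f hf) (k2 V b f hf)
    · simp only [Pi.add_apply, LinearMap.add_apply, h3 V b f g hf, k3 V b f g hf, mul_add, add_mul,
        smul_add]
      abel
  zero_mem' := by
    refine ⟨fun V W h f => ?_, fun V b f hf => ?_, fun V b f g hf => ?_⟩ <;> simp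
  smul_mem' := by
    rintro c D ⟨h1, h2, h3⟩
    refine ⟨fun V W h f => ?_, fun V b f hf => ?_, fun V b f g hf => ?_⟩
    · simp [h1 V W h]
    · exact Submodule.smul_mem _ c (h2 V b f hf)
    · simp only [Pi.smul_apply, LinearMap.smul_apply, h3 V b f g hf, smul_add, smul_mul_assoc,
        mul_smul_comm]
      rw [smul_comm]

/-- Vector fields on `U`, as pairs of an even and an odd part. -/
abbrev Vec (U : Opens M.body) : Type u := ∀ a : ZMod 2, M.homVec U a

variable {M} {U V W : Opens M.body}

/-- A homogeneous vector field, as a vector field. -/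
def Vec.of {a : ZMod 2} (X : M.homVec U a) : M.Vec U := Pi.single a X

/-- The homogeneous component of parity `a`, as a vector field. -/
def Vec.part (X : M.Vec U) (a : ZMod 2) : M.Vec U := Vec.of (X a)

/-- `X` is homogeneous of parity `a`. -/
def Vec.IsHom (X : M.Vec U) (a : ZMod 2) : Prop := X = X.part a

/-- The operator on superfunctions given by a vector field: the sum of those given by its even and
its odd part. -/
def Vec.oper (X : M.Vec U) : M.Oper U := ∑ a, (X a : M.Oper U)

/-- The action of a vector field on superfunctions. -/
def Vec.app (X : M.Vec U) (f : M.Fn U) : M.Fn U := X.oper ⟨U, le_rfl⟩ f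

/-- Restriction of vector fields to a smaller open set. -/
def Vec.restrict (h : V ≤ U) (X : M.Vec U) : M.Vec V := fun a =>
  ⟨fun W => (X a : M.Oper U) ⟨W.1, W.2.trans h⟩,
    fun W W' k f => (X a).2.1 ⟨W.1, W.2.trans h⟩ ⟨W'.1, W'.2.trans h⟩ k f,
    fun W => (X a).2.2.1 ⟨W.1, W.2.trans h⟩, fun W => (X a).2.2.2 ⟨W.1, W.2.trans h⟩⟩

/-- Left multiplication by a superfunction. -/
def mulOper (U : Opens M.body) : M.Fn U →+* M.Oper U where
  toFun f := fun V => LinearMap.mulLeft ℝ (M.res V.2 f)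
  map_one' := by ext; simp
  map_mul' f g := by ext; simp
  map_zero' := by ext; simp
  map_add' f g := by ext; simp [add_mul]

theorem koszulSign_add (a b : ZMod 2) : koszulSign (a + b) = koszulSign a * koszulSign b := by
  have h : ∀ a b : ZMod 2, (-1 : ℤ) ^ (a + b).val = (-1) ^ a.val * (-1) ^ b.val := by decide
  simpa [koszulSign] using congrArg (Int.cast : ℤ → ℝ) (h a b)

theorem mulOper_mem {a b c : ZMod 2} (hc : b + a = c) {f : M.Fn U} (hf : f ∈ M.parity U b)
    {D : M.Oper U} (hD : D ∈ M.homVec U a) : mulOper U f * D ∈ M.homVec U c := by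
  subst hc
  obtain ⟨h1, h2, h3⟩ := hD
  refine ⟨fun V W h g => ?_, fun V d g hg => ?_, fun V d g g' hg => ?_⟩
  · change M.res h (M.res V.2 f * D V g) = M.res W.2 f * D W (M.res h g)
    rw [map_mul, h1 V W h, res_res]
  · rw [add_assoc]
    exact SetLike.mul_mem_graded (M.parity_res _ hf) (h2 V d g hg)
  · have hs := M.supercomm (M.parity_res V.2 hf) hg
    change M.res V.2 f * g = koszulSign (b * d) • (g * M.res V.2 f) at hs
    have hk : koszulSign (b * d) * koszulSign (b * d) = 1 := by
      rw [← koszulSign_add, CharTwo.add_self_eq_zero]; simp [koszulSign]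
    change M.res V.2 f * D V (g * g') = M.res V.2 f * D V g * g' +
      koszulSign ((b + a) * d) • (g * (M.res V.2 f * D V g'))
    rw [h3 V d g g' hg, mul_add, add_mul b a d, koszulSign_add, mul_smul_comm, ← mul_assoc,
      ← mul_assoc, hs, smul_mul_assoc, smul_smul, mul_comm (koszulSign (a * d)), mul_assoc,
      mul_assoc]

/-- Left multiplication of a vector field by a superfunction, `(f X)(g) = f X(g)`, written out in
homogeneous components. -/
instance : SMul (M.Fn U) (M.Vec U) where
  smul f X := fun c => ⟨∑ a, mulOper U (GradedRing.proj (M.parity U) (c - a) f) * (X a : M.Oper U),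
    Submodule.sum_mem _ fun a _ => mulOper_mem (sub_add_cancel c a)
      (by rw [GradedRing.proj_apply]; exact SetLike.coe_mem _) (X a).2⟩

theorem sum_proj (f : M.Fn U) : ∑ c, GradedRing.proj (M.parity U) c f = f := by
  classical
  conv_rhs => rw [← DirectSum.sum_support_decompose (M.parity U) f]
  refine (Finset.sum_subset (Finset.subset_univ _) fun i _ hi => ?_).symm
  simpa using hi

theorem Vec.oper_smul (f : M.Fn U) (X : M.Vec U) : (f • X).oper = mulOper U f * X.oper := by
  change ∑ c, ∑ a, mulOper U (GradedRing.proj (M.parity U) (c - a) f) * (X a : M.Oper U) = _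
  rw [Finset.sum_comm, Vec.oper, Finset.mul_sum]
  refine Finset.sum_congr rfl fun a _ => ?_
  rw [← Finset.sum_mul, ← map_sum]
  congr 2
  rw [← Equiv.sum_comp (Equiv.addRight a)]
  simpa using sum_proj f

/-- `Vec.oper` as an additive map. -/
def Vec.operHom (U : Opens M.body) : M.Vec U →+ M.Oper U where
  toFun := Vec.oper
  map_zero' := by simp [Vec.oper]
  map_add' X Y := by simp [Vec.oper, Finset.sum_add_distrib]

theorem Vec.operHom_injective (U : Opens M.body) : Function.Injective (Vec.operHom (M := M) U) := by
  rw [injective_iff_map_eq_zero]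
  intro X hX
  funext a
  refine Subtype.ext (funext fun V => LinearMap.ext fun f => ?_)
  have key : ∀ b, (X a : M.Oper U) V (GradedRing.proj (M.parity V.1) b f) = 0 := by
    intro b
    have hb : GradedRing.proj (M.parity V.1) b f ∈ M.parity V.1 b := by
      rw [GradedRing.proj_apply]; exact SetLike.coe_mem _
    set g := GradedRing.proj (M.parity V.1) b f
    have h0 : ∑ c, (X c : M.Oper U) V g = 0 := by
      have := congrArg (fun D : M.Oper U => D V g) hX
      change (∑ c, (X c : M.Oper U)) V g = 0 at this
      simpa using this
    have h1 := congrArg (GradedRing.proj (M.parity V.1) (a + b)) h0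
    rw [map_sum, Finset.sum_eq_single a] at h1
    · rw [GradedRing.proj_apply, DirectSum.decompose_of_mem_same _ ((X a).2.2.1 V b g hb)] at h1
      simpa using h1
    · intro c _ hc
      rw [GradedRing.proj_apply, DirectSum.decompose_of_mem_ne _ ((X c).2.2.1 V b g hb)]
      simpa using hc
    · simp
  rw [← sum_proj f, map_sum, Finset.sum_eq_zero fun b _ => key b]
  simp

/-- Vector fields on `U` form a left module over the superfunctions on `U`. -/
instance : Module (M.Fn U) (M.Vec U) :=
  letI : Module (M.Fn U) (M.Oper U) := Module.compHom _ (mulOper U)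
  Function.Injective.module (M.Fn U) (Vec.operHom U) (Vec.operHom_injective U) Vec.oper_smul

theorem bracket_mem {a b c : ZMod 2} (hc : a + b = c) {D E : M.Oper U} (hD : D ∈ M.homVec U a)
    (hE : E ∈ M.homVec U b) : D * E - koszulSign (a * b) • (E * D) ∈ M.homVec U c := by
  subst hc
  obtain ⟨h1, h2, h3⟩ := hD
  obtain ⟨k1, k2, k3⟩ := hE
  refine ⟨fun V W h g => ?_, fun V d g hg => ?_, fun V d g g' hg => ?_⟩
  · simp [h1 V W h, k1 V W h]
  · refine sub_mem ?_ (Submodule.smul_mem _ _ ?_)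
    · rw [add_assoc]; exact h2 V _ _ (k2 V _ _ hg)
    · rw [add_comm a b, add_assoc]; exact k2 V _ _ (h2 V _ _ hg)
  · have hk : koszulSign (a * b) * koszulSign (a * b) = 1 := by
      rw [← koszulSign_add, CharTwo.add_self_eq_zero]; simp [koszulSign]
    change D V (E V (g * g')) - koszulSign (a * b) • E V (D V (g * g')) =
      (D V (E V g) - koszulSign (a * b) • E V (D V g)) * g' + koszulSign ((a + b) * d) •
        (g * (D V (E V g') - koszulSign (a * b) • E V (D V g')))
    rw [k3 V d g g' hg, h3 V d g g' hg, map_add, map_add, map_smul, map_smul,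
      h3 V _ _ _ (k2 V d g hg), h3 V d g _ hg, k3 V _ _ _ (h2 V d g hg), k3 V d g _ hg,
      add_mul a b d, mul_add a b d, mul_add b a d, koszulSign_add, koszulSign_add, koszulSign_add,
      mul_comm b a]
    simp only [sub_mul, mul_sub, smul_sub, smul_add, smul_smul, smul_mul_assoc, mul_smul_comm]
    rw [← mul_assoc (koszulSign (a * b)) (koszulSign (a * b)) (koszulSign (b * d)), hk, one_mul]
    module

/-- The super Lie bracket: the bilinear extension of `[X, Y] = X Y - (-1)^{|X||Y|} Y X` for
homogeneous `X`, `Y`. -/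
instance : Bracket (M.Vec U) (M.Vec U) where
  bracket X Y := fun c => ⟨∑ a, ((X a : M.Oper U) * (Y (c - a) : M.Oper U) -
      koszulSign (a * (c - a)) • ((Y (c - a) : M.Oper U) * (X a : M.Oper U))),
    Submodule.sum_mem _ fun a _ => bracket_mem (add_sub_cancel a c) (X a).2 (Y (c - a)).2⟩

variable (M) in
/-- `k`-cochains on `U`: functions that send `k` vector fields on an open `V ⊆ U` to a superfunction
on `V`. Differential forms are the superalternating multilinear natural ones; a `k`-form `η` is
identified with `(X₁, …, X_k) ↦ i_{X_k} ⋯ i_{X₁} η`. -/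
abbrev Cochain (U : Opens M.body) (k : ℕ) : Type u :=
  ∀ V : {V // V ≤ U}, (Fin k → M.Vec V.1) → M.Fn V.1

/-- Restriction of cochains to a smaller open set. -/
def Cochain.restrict {k : ℕ} (h : V ≤ U) (η : M.Cochain U k) : M.Cochain V k :=
  fun W => η ⟨W.1, W.2.trans h⟩

/-- Differential `k`-forms on `U`, with the sign rules `i_{fX} = f i_X`,
`i_Y f = (-1)^{|Y||f|} f i_Y` and `i_Y i_X = -(-1)^{|X||Y|} i_X i_Y` for homogeneous `f`, `X`, `Y`
(Deligne's convention). -/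
structure IsForm {k : ℕ} (η : M.Cochain U k) : Prop where
  natural : ∀ (V W : {V // V ≤ U}) (h : W.1 ≤ V.1) (X : Fin k → M.Vec V.1),
    M.res h (η V X) = η W fun i => (X i).restrict h
  map_add : ∀ (V : {V // V ≤ U}) (X : Fin k → M.Vec V.1) (i : Fin k) (Y Z : M.Vec V.1),
    η V (Function.update X i (Y + Z)) =
      η V (Function.update X i Y) + η V (Function.update X i Z)
  map_smul : ∀ (V : {V // V ≤ U}) (X : Fin k → M.Vec V.1) (s : Fin k → ZMod 2) (i : Fin k)
    (b : ZMod 2) (f : M.Fn V.1), (∀ j, (X j).IsHom (s j)) → f ∈ M.parity V.1 b →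
    η V (Function.update X i (f • X i)) =
      koszulSign (b * ∑ l ∈ Finset.Ioi i, s l) • (f * η V X)
  map_swap : ∀ (V : {V // V ≤ U}) (X : Fin k → M.Vec V.1) (s : Fin k → ZMod 2) (i j : Fin k),
    (∀ l, (X l).IsHom (s l)) → (i : ℕ) + 1 = j →
    η V (X ∘ Equiv.swap i j) = -(koszulSign (s i * s j) • η V X)

/-- The interior product `i_X`, the insertion of `X` in the first slot; it is zero on `0`-forms. -/
def interior (X : M.Vec U) : {k : ℕ} → M.Cochain U k → M.Cochain U (k - 1)
  | 0, _ => 0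
  | _ + 1, η => fun V Y => η V (Fin.cons (X.restrict V.2) Y)

/-- The Lie derivative `L_X`. For homogeneous `X` and `Y₁, …, Y_k` of parities `a` and `s₁, …, s_k`,
`(L_X η)(Y₁, …, Y_k) = (-1)^{a (s₁ + ⋯ + s_k)} X(η(Y₁, …, Y_k))
  - ∑_j (-1)^{a (s₁ + ⋯ + s_j)} η(Y₁, …, [X, Y_j], …, Y_k)`,
extended to all vector fields by summing over homogeneous components. -/
def lieDerivative {k : ℕ} (X : M.Vec U) (η : M.Cochain U k) : M.Cochain U k := fun V Y =>
  ∑ a : ZMod 2, ∑ s : Fin k → ZMod 2,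
    (koszulSign (a * ∑ l, s l) •
        ((X.restrict V.2).part a).app (η V fun i => (Y i).part (s i)) -
      ∑ j, koszulSign (a * ∑ l ∈ Finset.Iic j, s l) •
        η V (Function.update (fun i => (Y i).part (s i)) j
          ⁅(X.restrict V.2).part a, (Y j).part (s j)⁆))

/-- The exterior derivative, by the Koszul formula. For homogeneous `X₀, …, X_k` of parities
`s₀, …, s_k`,
`(dη)(X₀, …, X_k) = ∑_i (-1)^i (-1)^{s_i (s_{i+1} + ⋯ + s_k)} X_i(η(X₀, …, X̂_i, …, X_k))
  - ∑_{i<j} (-1)^i (-1)^{s_i (s_{i+1} + ⋯ + s_j)} η(X₀, …, X̂_i, …, [X_i, X_j], …, X_k)`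
with the bracket in the place of `X_j`, extended to all vector fields by summing over homogeneous
components. -/
def extDerivative {k : ℕ} (η : M.Cochain U k) : M.Cochain U (k + 1) := fun V X =>
  ∑ s : Fin (k + 1) → ZMod 2, ∑ i : Fin (k + 1), (-1 : ℝ) ^ (i : ℕ) •
    (koszulSign (s i * ∑ l ∈ Finset.Ioi i, s l) •
        ((X i).part (s i)).app (η V (i.removeNth fun l => (X l).part (s l))) -
      ∑ j ∈ Finset.Ioi i, koszulSign (s i * ∑ l ∈ Finset.Ioc i j, s l) •
        η V (i.removeNth (Function.update (fun l => (X l).part (s l)) j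
          ⁅(X i).part (s i), (X j).part (s j)⁆)))

/-- The characteristic set `ker α ∩ ker dα` of a form `α` on `M`, as the assignment to each open
set `U` of the set of vector fields `X` on `U` with `i_X α = 0` and `i_X dα = 0`. -/
def characteristicSet {k : ℕ} (α : M.Cochain ⊤ k) (U : Opens M.body) : Set (M.Vec U) :=
  {X | interior X (α.restrict le_top) = 0 ∧ interior X ((extDerivative α).restrict le_top) = 0}

/-- `D` is a distribution of rank `r`, i.e. (the sheaf of sections of) a vector subbundle of rank `r`
of the tangent bundle: near every point there is a frame of the tangent bundle, consisting of
homogeneous vector fields, whose first `r` members freely generate `D`. -/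
def IsDistribution (D : ∀ U : Opens M.body, Set (M.Vec U)) (r : ℕ) : Prop :=
  ∀ x : M.body, ∃ U : Opens M.body, x ∈ U ∧ ∃ (m : ℕ) (e : Fin r ⊕ Fin m → M.Vec U),
    (∀ i, ∃ a, (e i).IsHom a) ∧
    ∀ (V : Opens M.body) (h : V ≤ U),
      LinearIndependent (M.Fn V) (fun i => (e i).restrict h) ∧
      Submodule.span (M.Fn V) (Set.range fun i => (e i).restrict h) = ⊤ ∧
      D V = Submodule.span (M.Fn V) (Set.range fun i => (e (Sum.inl i)).restrict h)

/-- `D` is closed under the super Lie bracket. -/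
def IsInvolutive (D : ∀ U : Opens M.body, Set (M.Vec U)) : Prop :=
  ∀ (U : Opens M.body) (X Y : M.Vec U), X ∈ D U → Y ∈ D U → ⁅X, Y⁆ ∈ D U

/-- A form is regular if its characteristic set is a distribution of some rank. -/
def IsRegular {k : ℕ} (α : M.Cochain ⊤ k) : Prop :=
  ∃ r : ℕ, IsDistribution (characteristicSet α) r

end Supermanifold

end

namespace Supermanifold

variable {p q : ℕ} {M : Supermanifold.{u} p q} {U V : Opens M.body}

/-! The proof is the Cartan calculus, carried out on homogeneous vector fields. If `i_X α = 0`,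
Cartan's formula reduces to `L_X α = i_X dα` (`extDerivative_cons`), so `L_X α = 0` for every `X` in
`χ(α)`. This is the second claim. For involutivity, `i_[X,Y] α` is the supercommutator of `L_X` and
`i_Y` applied to `α`, hence zero (`IsKilledBy.bracket`). Likewise `L_[X,Y] α` is the supercommutator
of `L_X` and `L_Y` applied to `α`, hence zero (`lieTerm_bracket_eq_zero`). Cartan's formula for
`[X,Y]` then gives `i_[X,Y] dα = 0`.

Regularity is what permits the reduction to homogeneous fields. Since `α` may have mixed parity,
`i_X α = 0` does not by itself give the same for the even and odd parts of `X`. Locally, however,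
`χ(α)` is spanned by homogeneous fields and so is a graded submodule. Membership in `χ(α)` is a
local condition, so parts and sums stay in it (`IsRegular.part_mem`, `IsRegular.add_mem`). -/

theorem fn_eq_of_locally_eq {f g : M.Fn U}
    (H : ∀ x ∈ U, ∃ V, ∃ h : V ≤ U, x ∈ V ∧ M.res h f = M.res h g) : f = g := by
  choose! V hV hx hf using H
  refine TopCat.Sheaf.eq_of_locally_eq' M.structureSheaf (fun x : U => V x) U
    (fun x => homOfLE (hV x x.2)) (fun x hx' => ?_) f g fun x => hf x x.2
  exact Opens.mem_iSup.2 ⟨⟨x, hx'⟩, hx x hx'⟩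

theorem koszulSign_mul_self (a : ZMod 2) : koszulSign a * koszulSign a = 1 := by
  rw [← koszulSign_add, CharTwo.add_self_eq_zero]
  simp [koszulSign]

/-! ### Homogeneous components and the super Lie bracket. -/

namespace Vec

theorem sum_part (X : M.Vec U) : ∑ a, X.part a = X :=
  Finset.univ_sum_single X

theorem isHom_part (X : M.Vec U) (a : ZMod 2) : (X.part a).IsHom a := by
  simp [IsHom, part, of]

theorem part_part_of_ne (X : M.Vec U) {a b : ZMod 2} (h : a ≠ b) : (X.part a).part b = 0 := by
  simp [part, of, Pi.single_eq_of_ne' h]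

theorem IsHom.part_of_ne {X : M.Vec U} {a b : ZMod 2} (hX : X.IsHom a) (h : a ≠ b) :
    X.part b = 0 := by
  rw [hX, part_part_of_ne X h]

theorem part_add (X Y : M.Vec U) (a : ZMod 2) : (X + Y).part a = X.part a + Y.part a :=
  Pi.single_add _ _ _

theorem part_zero (a : ZMod 2) : (0 : M.Vec U).part a = 0 :=
  Pi.single_zero _

theorem oper_part (X : M.Vec U) (a : ZMod 2) : (X.part a).oper = X a := by
  rw [oper, Finset.sum_eq_single a]
  · simp [part, of]
  · intro b _ hb
    simp [part, of, Pi.single_eq_of_ne hb]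
  · simp

theorem oper_injective {X Y : M.Vec U} (h : X.oper = Y.oper) : X = Y :=
  operHom_injective U h

theorem oper_zero : (0 : M.Vec U).oper = 0 := map_zero (operHom U)

theorem oper_add (X Y : M.Vec U) : (X + Y).oper = X.oper + Y.oper := map_add (operHom U) X Y

theorem oper_real_smul (c : ℝ) (X : M.Vec U) : (c • X).oper = c • X.oper := by
  simp [oper, Finset.smul_sum]

theorem oper_bracket (X Y : M.Vec U) : ⁅X, Y⁆.oper = ∑ a, ∑ b,
    ((X a : M.Oper U) * (Y b : M.Oper U) - koszulSign (a * b) •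
      ((Y b : M.Oper U) * (X a : M.Oper U))) := by
  change ∑ c, ∑ a, ((X a : M.Oper U) * (Y (c - a) : M.Oper U) -
      koszulSign (a * (c - a)) • ((Y (c - a) : M.Oper U) * (X a : M.Oper U))) = _
  rw [Finset.sum_comm]
  exact Finset.sum_congr rfl fun a _ => Equiv.sum_comp (Equiv.subRight a) fun b =>
    ((X a : M.Oper U) * (Y b : M.Oper U) - koszulSign (a * b) •
      ((Y b : M.Oper U) * (X a : M.Oper U)))

theorem oper_bracket_part (X Y : M.Vec U) (a b : ZMod 2) : ⁅X.part a, Y.part b⁆.oper =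
    (X a : M.Oper U) * (Y b : M.Oper U) - koszulSign (a * b) •
      ((Y b : M.Oper U) * (X a : M.Oper U)) := by
  rw [oper_bracket, Finset.sum_eq_single a, Finset.sum_eq_single b]
  · simp [part, of]
  · intro c _ hc
    simp [part, of, Pi.single_eq_of_ne hc]
  · simp
  · intro c _ hc
    simp [part, of, Pi.single_eq_of_ne hc]
  · simp

theorem oper_bracket_of_isHom {X Y : M.Vec U} {a b : ZMod 2} (hX : X.IsHom a) (hY : Y.IsHom b) :
    ⁅X, Y⁆.oper = X.oper * Y.oper - koszulSign (a * b) • (Y.oper * X.oper) := by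
  rw [hX, hY, oper_bracket_part, oper_part, oper_part]

theorem bracket_eq_sum_part (X Y : M.Vec U) : ⁅X, Y⁆ = ∑ a, ∑ b, ⁅X.part a, Y.part b⁆ := by
  apply oper_injective
  change _ = operHom U _
  simp only [map_sum]
  rw [oper_bracket]
  exact Finset.sum_congr rfl fun a _ => Finset.sum_congr rfl fun b _ =>
    (oper_bracket_part X Y a b).symm

theorem bracket_zero (X : M.Vec U) : ⁅X, (0 : M.Vec U)⁆ = 0 := by
  apply oper_injective
  simp [oper_bracket, oper_zero]

theorem zero_bracket (X : M.Vec U) : ⁅(0 : M.Vec U), X⁆ = 0 := by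
  apply oper_injective
  simp [oper_bracket, oper_zero]

theorem IsHom.bracket {X Y : M.Vec U} {a b : ZMod 2} (hX : X.IsHom a) (hY : Y.IsHom b) :
    ⁅X, Y⁆.IsHom (a + b) := by
  apply oper_injective
  rw [oper_part, oper_bracket_of_isHom hX hY, hX, hY, oper_part, oper_part]
  change _ = ∑ c, ((X.part a c : M.Oper U) * (Y.part b (a + b - c) : M.Oper U) -
      koszulSign (c * (a + b - c)) • ((Y.part b (a + b - c) : M.Oper U) * (X.part a c : M.Oper U)))
  rw [Finset.sum_eq_single a]
  · rw [add_sub_cancel_left]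
    simp [part, of]
  · intro c _ hc
    simp [part, of, Pi.single_eq_of_ne hc]
  · simp

/-- The super Jacobi identity: once brackets are written as supercommutators in the associative
algebra of operators, only a comparison of signs remains. -/
theorem leibniz_bracket {X Y Z : M.Vec U} {a b c : ZMod 2} (hX : X.IsHom a) (hY : Y.IsHom b)
    (hZ : Z.IsHom c) :
    ⁅X, ⁅Y, Z⁆⁆ = ⁅⁅X, Y⁆, Z⁆ + koszulSign (a * b) • ⁅Y, ⁅X, Z⁆⁆ := by
  apply oper_injective
  rw [oper_add, oper_real_smul, oper_bracket_of_isHom hX (hY.bracket hZ), oper_bracket_of_isHom (hX.bracket hY) hZ,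
    oper_bracket_of_isHom hY (hX.bracket hZ), oper_bracket_of_isHom hX hY,
    oper_bracket_of_isHom hX hZ, oper_bracket_of_isHom hY hZ]
  simp only [mul_add, add_mul, koszulSign_add, mul_sub, sub_mul, smul_sub, smul_smul,
    mul_smul_comm, smul_mul_assoc, mul_assoc, mul_comm b a]
  have h := koszulSign_mul_self (a * b)
  have h' : ∀ x, koszulSign (a * b) * (koszulSign (a * b) * x) = x := fun x => by
    rw [← mul_assoc, h, one_mul]
  simp only [h']
  module

theorem restrict_part (h : V ≤ U) (X : M.Vec U) (a : ZMod 2) :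
    (X.part a).restrict h = (X.restrict h).part a := by
  funext b
  by_cases hb : b = a
  · subst hb
    simp [part, of, restrict]
  · simp only [part, of, restrict, Pi.single_eq_of_ne hb]
    rfl

theorem restrict_bracket (h : V ≤ U) (X Y : M.Vec U) :
    ⁅X, Y⁆.restrict h = ⁅X.restrict h, Y.restrict h⁆ := by
  funext c
  refine Subtype.ext (funext fun W => ?_)
  simp [restrict, Bracket.bracket]

theorem IsHom.restrict {X : M.Vec U} {a : ZMod 2} (hX : X.IsHom a) (h : V ≤ U) :
    (X.restrict h).IsHom a := by
  rw [IsHom, ← restrict_part, ← hX]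

/-- The action of a vector field on superfunctions as a linear map. -/
def appLinear (X : M.Vec U) : Module.End ℝ (M.Fn U) := X.oper ⟨U, le_rfl⟩

theorem appLinear_apply (X : M.Vec U) (f : M.Fn U) : X.appLinear f = X.app f := rfl

theorem app_zero (X : M.Vec U) : X.app 0 = 0 := map_zero X.appLinear

theorem zero_app (f : M.Fn U) : (0 : M.Vec U).app f = 0 := by
  simp [app, oper_zero]

theorem res_app (h : V ≤ U) (X : M.Vec U) (f : M.Fn U) :
    M.res h (X.app f) = (X.restrict h).app (M.res h f) := by
  have key : ∀ a, M.res h ((X a : M.Oper U) ⟨U, le_rfl⟩ f) =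
      (X a : M.Oper U) ⟨V, h⟩ (M.res h f) := fun a => (X a).2.1 ⟨U, le_rfl⟩ ⟨V, h⟩ h f
  simp [app, oper, Finset.sum_apply, key, Vec.restrict]

theorem bracket_app {X Y : M.Vec U} {a b : ZMod 2} (hX : X.IsHom a) (hY : Y.IsHom b)
    (f : M.Fn U) :
    ⁅X, Y⁆.app f = X.app (Y.app f) - koszulSign (a * b) • Y.app (X.app f) := by
  rw [app, oper_bracket_of_isHom hX hY]
  rfl

end Vec


/-! ### Multiadditive functions and reduction to homogeneous arguments. -/

/-- A function of several vector fields is multiadditive if it is additive in each of them. -/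
def IsMultiAdditive {k : ℕ} (η : (Fin k → M.Vec U) → M.Fn U) : Prop :=
  ∀ (X : Fin k → M.Vec U) (i : Fin k) (Y Z : M.Vec U),
    η (Function.update X i (Y + Z)) = η (Function.update X i Y) + η (Function.update X i Z)

namespace IsMultiAdditive

variable {k : ℕ} {η : (Fin k → M.Vec U) → M.Fn U}

/-- A multiadditive function as an additive function of its `i`-th argument. -/
def slotHom (hη : IsMultiAdditive η) (X : Fin k → M.Vec U) (i : Fin k) : M.Vec U →+ M.Fn U :=
  AddMonoidHom.mk' (fun Y => η (Function.update X i Y)) (hη X i)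

/-- A multiadditive function as a multilinear map over `ℕ`. -/
def toMultilinearMap (hη : IsMultiAdditive η) :
    MultilinearMap ℕ (fun _ : Fin k => M.Vec U) (M.Fn U) where
  toFun := η
  map_update_add' {inst} X i Y Z := by
    rw [Subsingleton.elim inst (instDecidableEqFin k)]
    exact hη X i Y Z
  map_update_smul' {inst} X i n Y := by
    rw [Subsingleton.elim inst (instDecidableEqFin k)]
    exact map_nsmul (hη.slotHom X i) n Y

theorem eq_sum_part (hη : IsMultiAdditive η) (Z : Fin k → M.Vec U) :
    η Z = ∑ s : Fin k → ZMod 2, η fun i => (Z i).part (s i) := by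
  have h := hη.toMultilinearMap.map_sum fun i (a : ZMod 2) => (Z i).part a
  simp only [Vec.sum_part] at h
  exact h

theorem eq_zero_of_coord (hη : IsMultiAdditive η) {Z : Fin k → M.Vec U} (i : Fin k)
    (h : Z i = 0) : η Z = 0 :=
  hη.toMultilinearMap.map_coord_zero i h

/-- Additivity alone suffices here, without real linearity, because a Koszul sign is `1` or `-1`. -/
theorem map_update_koszulSign_smul (hη : IsMultiAdditive η) (Z : Fin k → M.Vec U) (i : Fin k)
    (a : ZMod 2) (X : M.Vec U) :
    η (Function.update Z i (koszulSign a • X)) = koszulSign a • η (Function.update Z i X) := by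
  have h : koszulSign a = 1 ∨ koszulSign a = -1 := neg_one_pow_eq_or ℝ _
  rcases h with h | h
  · simp [h]
  · have hX : (-1 : ℝ) • X = -X := funext fun b => neg_one_smul ℝ (X b)
    rw [h, hX, neg_one_smul]
    exact map_neg (hη.slotHom Z i) X

end IsMultiAdditive

theorem IsForm.isMultiAdditive {k : ℕ} {η : M.Cochain U k} (hη : IsForm η) (V : {V // V ≤ U}) :
    IsMultiAdditive (η V) := hη.map_add V

/-! ### Lie derivatives on homogeneous arguments and their commutator. -/

/-- The Lie derivative of a cochain along `X` of parity `a`, evaluated at vector fields of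
parities `s`. -/
def lieTerm {k : ℕ} (η : (Fin k → M.Vec U) → M.Fn U) (a : ZMod 2) (X : M.Vec U)
    (s : Fin k → ZMod 2) (Z : Fin k → M.Vec U) : M.Fn U :=
  koszulSign (a * ∑ l, s l) • X.app (η Z) -
    ∑ j, koszulSign (a * ∑ l ∈ Finset.Iic j, s l) • η (Function.update Z j ⁅X, Z j⁆)

theorem lieDerivative_apply {k : ℕ} (X : M.Vec U) (η : M.Cochain U k) (V : {V // V ≤ U})
    (Y : Fin k → M.Vec V.1) : lieDerivative X η V Y =
      ∑ a, ∑ s : Fin k → ZMod 2,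
        lieTerm (η V) a ((X.restrict V.2).part a) s fun i => (Y i).part (s i) := rfl

section lieTerm

variable {k : ℕ} {η : (Fin k → M.Vec U) → M.Fn U}

theorem lieTerm_eq_zero_of_coord (hη : IsMultiAdditive η) (a : ZMod 2) (X : M.Vec U)
    (s : Fin k → ZMod 2) {Z : Fin k → M.Vec U} (i : Fin k) (h : Z i = 0) :
    lieTerm η a X s Z = 0 := by
  rw [lieTerm, hη.eq_zero_of_coord i h, Vec.app_zero, smul_zero, zero_sub, neg_eq_zero]
  refine Finset.sum_eq_zero fun j _ => ?_
  rw [hη.eq_zero_of_coord i, smul_zero]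
  by_cases hj : i = j
  · subst hj
    simp [h, Vec.bracket_zero]
  · simp [Function.update_of_ne hj, h]

theorem lieTerm_zero_left (hη : IsMultiAdditive η) (a : ZMod 2)
    (s : Fin k → ZMod 2) (Z : Fin k → M.Vec U) : lieTerm η a 0 s Z = 0 := by
  rw [lieTerm, Vec.zero_app, smul_zero, zero_sub, neg_eq_zero]
  refine Finset.sum_eq_zero fun j _ => ?_
  rw [hη.eq_zero_of_coord j, smul_zero]
  simp [Vec.zero_bracket]

theorem sum_lieTerm_of_isHom (hη : IsMultiAdditive η) {a : ZMod 2} {X : M.Vec U} (hX : X.IsHom a)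
    {s : Fin k → ZMod 2} {Z : Fin k → M.Vec U} (hZ : ∀ i, (Z i).IsHom (s i)) :
    ∑ b, ∑ t : Fin k → ZMod 2, lieTerm η b (X.part b) t (fun i => (Z i).part (t i)) =
      lieTerm η a X s Z := by
  rw [Finset.sum_eq_single a, Finset.sum_eq_single s]
  · rw [← hX]
    congr 1
    funext i
    exact (hZ i).symm
  · intro t _ ht
    obtain ⟨i, hi⟩ := Function.ne_iff.1 ht
    exact lieTerm_eq_zero_of_coord hη _ _ _ i ((hZ i).part_of_ne (Ne.symm hi))
  · simp
  · intro b _ hb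
    rw [hX.part_of_ne (Ne.symm hb)]
    exact Finset.sum_eq_zero fun t _ => lieTerm_zero_left hη _ _ _
  · simp

theorem isHom_update {Z : Fin k → M.Vec U} {s : Fin k → ZMod 2} (hZ : ∀ i, (Z i).IsHom (s i))
    (j : Fin k) {X : M.Vec U} {a : ZMod 2} (hX : X.IsHom a) (i : Fin k) :
    (Function.update Z j X i).IsHom (Function.update s j a i) := by
  by_cases h : i = j
  · subst h
    simpa using hX
  · simpa [Function.update_of_ne h] using hZ i

/-- Tracks the Koszul exponents when `Z j` is replaced by a bracket `⁅X, Z j⁆`, whose parity is `a +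
s j`. -/
theorem sum_update_add (s : Fin k → ZMod 2) (j : Fin k) (a : ZMod 2) (A : Finset (Fin k)) :
    ∑ l ∈ A, Function.update s j (a + s j) l = (if j ∈ A then a else 0) + ∑ l ∈ A, s l := by
  have h : ∀ l, Function.update s j (a + s j) l = (if l = j then a else 0) + s l := by
    intro l
    by_cases h : l = j
    · subst h
      simp
    · simp [h]
  simp [h, Finset.sum_add_distrib]

/-- The iterated Lie derivative along `X` and `Y` of a function on which both vanish. -/
theorem app_app_of_lieTerm_eq_zero {a b : ZMod 2} {X Y : M.Vec U} (hY : Y.IsHom b)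
    (hLX : ∀ s Z, (∀ i, (Z i).IsHom (s i)) → lieTerm η a X s Z = 0)
    (hLY : ∀ s Z, (∀ i, (Z i).IsHom (s i)) → lieTerm η b Y s Z = 0)
    {s : Fin k → ZMod 2} {Z : Fin k → M.Vec U} (hZ : ∀ i, (Z i).IsHom (s i)) :
    koszulSign ((a + b) * ∑ l, s l) • X.app (Y.app (η Z)) =
      ∑ i, ∑ j, (koszulSign (a * b) * koszulSign (b * ∑ l ∈ Finset.Iic i, s l) *
        koszulSign (a * ((if i ≤ j then b else 0) + ∑ l ∈ Finset.Iic j, s l))) •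
        η (Function.update (Function.update Z i ⁅Y, Z i⁆) j
          ⁅X, Function.update Z i ⁅Y, Z i⁆ j⁆) := by
  have h1 := sub_eq_zero.1 (hLY s Z hZ)
  -- The factor `koszulSign (a * b)` appears because bracketing one argument with `Y` raises the
  -- total parity by `b`.
  have h2 : ∀ i, koszulSign (a * ∑ l, s l) • X.app (η (Function.update Z i ⁅Y, Z i⁆)) =
      ∑ j, (koszulSign (a * b) *
        koszulSign (a * ((if i ≤ j then b else 0) + ∑ l ∈ Finset.Iic j, s l))) •
        η (Function.update (Function.update Z i ⁅Y, Z i⁆) j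
          ⁅X, Function.update Z i ⁅Y, Z i⁆ j⁆) := by
    intro i
    have h := sub_eq_zero.1 (hLX (Function.update s i (b + s i)) (Function.update Z i ⁅Y, Z i⁆)
      (isHom_update hZ i (hY.bracket (hZ i))))
    simp only [sum_update_add, Finset.mem_univ, if_true, Finset.mem_Iic] at h
    simp only [mul_smul, ← Finset.smul_sum]
    rw [← h, mul_add, koszulSign_add, smul_smul, ← mul_assoc, koszulSign_mul_self, one_mul]
  rw [add_mul, koszulSign_add, mul_smul, ← Vec.appLinear_apply X, ← map_smul X.appLinear, h1,
    map_sum, Finset.smul_sum]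
  refine Finset.sum_congr rfl fun i _ => ?_
  rw [map_smul, smul_comm, Vec.appLinear_apply, h2, Finset.smul_sum]
  refine Finset.sum_congr rfl fun j _ => ?_
  rw [smul_smul]
  congr 1
  ring

/-- Vanishing of both Lie derivatives turns `X(Y(η Z))` and `Y(X(η Z))` into double sums over the
slots where `X` and `Y` act. Terms with distinct slots cancel; those with equal slots combine by the
Jacobi identity into the bracket terms of `⁅X, Y⁆`. -/
theorem lieTerm_bracket_eq_zero (hη : IsMultiAdditive η) {a b : ZMod 2} {X Y : M.Vec U}
    (hX : X.IsHom a) (hY : Y.IsHom b)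
    (hLX : ∀ s Z, (∀ i, (Z i).IsHom (s i)) → lieTerm η a X s Z = 0)
    (hLY : ∀ s Z, (∀ i, (Z i).IsHom (s i)) → lieTerm η b Y s Z = 0)
    {s : Fin k → ZMod 2} {Z : Fin k → M.Vec U} (hZ : ∀ i, (Z i).IsHom (s i)) :
    lieTerm η (a + b) ⁅X, Y⁆ s Z = 0 := by
  rw [lieTerm, Vec.bracket_app hX hY, smul_sub, app_app_of_lieTerm_eq_zero hY hLX hLY hZ, smul_comm,
    add_comm a b, app_app_of_lieTerm_eq_zero hX hLY hLX hZ, Finset.sum_comm, Finset.smul_sum,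
    ← Finset.sum_sub_distrib, ← Finset.sum_sub_distrib]
  -- After the interchange of sums, `j` is the slot of `X` and the inner index `i` the slot of `Y`
  -- in both double sums.
  refine Finset.sum_eq_zero fun j _ => ?_
  rw [Finset.smul_sum, ← Finset.sum_sub_distrib, Finset.sum_eq_single j, sub_eq_zero]
  · simp only [le_refl, if_true, Function.update_self, Function.update_idem]
    rw [Vec.leibniz_bracket hX hY (hZ j), hη, hη.map_update_koszulSign_smul]
    simp only [mul_add, add_mul, koszulSign_add, mul_comm b a, smul_add, smul_smul]
    have h := koszulSign_mul_self (a * b)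
    match_scalars
    · linear_combination (koszulSign (b * ∑ l ∈ Finset.Iic j, s l) *
        koszulSign (a * ∑ l ∈ Finset.Iic j, s l)) * h
    · ring
  · intro i _ hij
    have hc : Function.update (Function.update Z i ⁅Y, Z i⁆) j
        ⁅X, Function.update Z i ⁅Y, Z i⁆ j⁆ =
        Function.update (Function.update Z j ⁅X, Z j⁆) i ⁅Y, Function.update Z j ⁅X, Z j⁆ i⁆ := by
      rw [Function.update_of_ne hij, Function.update_of_ne (Ne.symm hij), Function.update_comm hij]
    rw [hc, smul_smul, ← sub_smul]
    have h := koszulSign_mul_self (a * b)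
    have h0 : koszulSign 0 = 1 := by simp [koszulSign]
    -- The slot order decides which of the two iterated derivatives contributes the extra
    -- `koszulSign (a * b)`.
    rcases lt_or_gt_of_ne hij with hl | hl
    · simp only [hl.le, hl.not_ge, if_true, if_false, mul_add, koszulSign_add, mul_comm b a,
        mul_zero, h0]
      match_scalars
      ring
    · simp only [hl.le, hl.not_ge, if_true, if_false, mul_add, koszulSign_add, mul_comm b a,
        mul_zero, h0]
      match_scalars
      linear_combination (-koszulSign (a * b) * koszulSign (b * ∑ l ∈ Finset.Iic i, s l) *
        koszulSign (a * ∑ l ∈ Finset.Iic j, s l)) * h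
  · simp

end lieTerm

variable {k : ℕ}


/-! ### Locality of the characteristic set. -/

/-- A cochain is natural if it commutes with restriction. -/
def IsNatural (η : M.Cochain U k) : Prop :=
  ∀ (V W : {V // V ≤ U}) (h : W.1 ≤ V.1) (X : Fin k → M.Vec V.1),
    M.res h (η V X) = η W fun i => (X i).restrict h

theorem IsNatural.extDerivative {η : M.Cochain U k} (hη : IsNatural η) :
    IsNatural (extDerivative η) := by
  intro V W h X
  have hr : ∀ (Y : Fin (k + 1) → M.Vec V.1) (i : Fin (k + 1)),
      (fun l => (i.removeNth Y l).restrict h) = i.removeNth fun l => (Y l).restrict h :=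
    fun _ _ => rfl
  have hu : ∀ (Y : Fin (k + 1) → M.Vec V.1) (j : Fin (k + 1)) (Z : M.Vec V.1),
      (fun l => (Function.update Y j Z l).restrict h) =
        Function.update (fun l => (Y l).restrict h) j (Z.restrict h) := by
    intro Y j Z
    funext l
    exact Function.apply_update (fun _ => Vec.restrict h) Y j Z l
  simp only [Supermanifold.extDerivative, map_sum, map_sub, map_smul, Vec.res_app, hη V W h, hr, hu,
    Vec.restrict_part, Vec.restrict_bracket]

/-- The vector field `X` on `U` is annihilated by the cochain `η`: `η` vanishes whenever its first
argument is a restriction of `X`. -/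
def IsKilledBy (X : M.Vec U) (η : M.Cochain ⊤ k) : Prop :=
  ∀ (V : Opens M.body) (h : V ≤ U) (Z : Fin k → M.Vec V) (hk : 0 < k),
    Z ⟨0, hk⟩ = X.restrict h → η ⟨V, le_top⟩ Z = 0

theorem interior_eq_zero_iff {X : M.Vec U} {η : M.Cochain ⊤ k} :
    interior X (η.restrict le_top) = 0 ↔ IsKilledBy X η := by
  cases k with
  -- In degree `0` the interior product is zero by convention, and `IsKilledBy` is vacuous because
  -- of its hypothesis `0 < k`.
  | zero => exact ⟨fun _ _ _ _ hk => absurd hk (lt_irrefl 0), fun _ => rfl⟩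
  | succ k =>
    constructor
    · intro H V h Z hk hZ
      have := congrFun (congrFun H ⟨V, h⟩) (Fin.tail Z)
      change η ⟨V, le_top⟩ (Fin.cons (X.restrict h) (Fin.tail Z)) = 0 at this
      rwa [← hZ, Fin.zero_eta, Fin.cons_self_tail] at this
    · intro H
      funext V Z
      exact H V.1 V.2 _ k.succ_pos rfl

theorem mem_characteristicSet {X : M.Vec U} {α : M.Cochain ⊤ k} :
    X ∈ characteristicSet α U ↔ IsKilledBy X α ∧ IsKilledBy X (extDerivative α) :=
  and_congr interior_eq_zero_iff interior_eq_zero_iff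

theorem IsKilledBy.restrict {X : M.Vec U} {η : M.Cochain ⊤ k} (hX : IsKilledBy X η) (h : V ≤ U) :
    IsKilledBy (X.restrict h) η :=
  fun V' h' Z hk hZ => hX V' (h'.trans h) Z hk hZ

/-- Naturality moves the restriction onto the arguments, and the sheaf property detects zero
locally. -/
theorem isKilledBy_of_locally {X : M.Vec U} {η : M.Cochain ⊤ k} (hη : IsNatural η)
    (H : ∀ x ∈ U, ∃ V, ∃ h : V ≤ U, x ∈ V ∧ IsKilledBy (X.restrict h) η) : IsKilledBy X η := by
  intro V h Z hk hZ
  refine fn_eq_of_locally_eq fun x hx => ?_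
  obtain ⟨V', h', hx', hV'⟩ := H x (h hx)
  refine ⟨V ⊓ V', inf_le_left, ⟨hx, hx'⟩, ?_⟩
  rw [hη ⟨V, le_top⟩ ⟨V ⊓ V', le_top⟩ inf_le_left, map_zero]
  exact hV' (V ⊓ V') inf_le_right _ hk (by rw [hZ]; rfl)

theorem restrict_mem_characteristicSet {X : M.Vec U} {α : M.Cochain ⊤ k}
    (hX : X ∈ characteristicSet α U) (h : V ≤ U) : X.restrict h ∈ characteristicSet α V := by
  rw [mem_characteristicSet] at hX ⊢
  exact ⟨hX.1.restrict h, hX.2.restrict h⟩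

theorem mem_characteristicSet_of_locally {X : M.Vec U} {α : M.Cochain ⊤ k} (hα : IsNatural α)
    (H : ∀ x ∈ U, ∃ V, ∃ h : V ≤ U, x ∈ V ∧ X.restrict h ∈ characteristicSet α V) :
    X ∈ characteristicSet α U := by
  simp only [mem_characteristicSet] at H ⊢
  refine ⟨isKilledBy_of_locally hα fun x hx => ?_,
    isKilledBy_of_locally hα.extDerivative fun x hx => ?_⟩ <;>
  obtain ⟨V, h, hxV, h1, h2⟩ := H x hx
  exacts [⟨V, h, hxV, h1⟩, ⟨V, h, hxV, h2⟩]

/-! ### Grading and additivity of the characteristic set of a regular form. -/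

theorem Vec.part_smul (f : M.Fn U) (X : M.Vec U) (a : ZMod 2) :
    (f • X).part a = ∑ b, GradedRing.proj (M.parity U) (a - b) f • X.part b := by
  apply Vec.oper_injective
  rw [Vec.oper_part]
  change ∑ b, mulOper U (GradedRing.proj (M.parity U) (a - b) f) * (X b : M.Oper U) = Vec.operHom U _
  rw [map_sum]
  refine Finset.sum_congr rfl fun b _ => ?_
  change _ = (_ • X.part b : M.Vec U).oper
  rw [Vec.oper_smul, Vec.oper_part]

/-- A submodule generated by homogeneous elements is graded; this is where homogeneity of the local
frame enters. -/
theorem part_mem_span {ι : Type*} {e : ι → M.Vec U} (he : ∀ i, ∃ a, (e i).IsHom a) {X : M.Vec U}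
    (hX : X ∈ Submodule.span (M.Fn U) (Set.range e)) (a : ZMod 2) :
    X.part a ∈ Submodule.span (M.Fn U) (Set.range e) := by
  induction hX using Submodule.span_induction generalizing a with
  | mem Y hY =>
    obtain ⟨i, rfl⟩ := hY
    obtain ⟨b, hb⟩ := he i
    by_cases hab : b = a
    · subst hab
      rw [← hb]
      exact Submodule.subset_span ⟨i, rfl⟩
    · rw [hb.part_of_ne hab]
      exact zero_mem _
  | zero =>
    rw [Vec.part_zero]
    exact zero_mem _
  | add Y Z _ _ hY hZ =>
    rw [Vec.part_add]
    exact add_mem (hY a) (hZ a)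
  | smul f Y _ hY =>
    rw [Vec.part_smul]
    exact Submodule.sum_mem _ fun b _ => Submodule.smul_mem _ _ (hY b)

/-- Locally, the characteristic set of a regular form is a graded submodule. -/
theorem IsRegular.exists_submodule {α : M.Cochain ⊤ k} (hreg : IsRegular α) {x : M.body}
    (hx : x ∈ U) : ∃ V ≤ U, x ∈ V ∧ ∃ N : Submodule (M.Fn V) (M.Vec V),
      characteristicSet α V = N ∧ ∀ X ∈ N, ∀ a, X.part a ∈ N := by
  obtain ⟨r, hr⟩ := hreg
  obtain ⟨U', hx', m, e, he, H⟩ := hr x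
  refine ⟨U ⊓ U', inf_le_left, ⟨hx, hx'⟩, _, (H (U ⊓ U') inf_le_right).2.2, fun X hX a => ?_⟩
  refine part_mem_span (fun i => ?_) hX a
  obtain ⟨b, hb⟩ := he (Sum.inl i)
  exact ⟨b, hb.restrict _⟩

theorem IsRegular.part_mem {α : M.Cochain ⊤ k} (hreg : IsRegular α) (hα : IsNatural α)
    {X : M.Vec U} (hX : X ∈ characteristicSet α U) (a : ZMod 2) :
    X.part a ∈ characteristicSet α U := by
  refine mem_characteristicSet_of_locally hα fun x hx => ?_
  obtain ⟨V, h, hxV, N, hN, hpart⟩ := hreg.exists_submodule hx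
  refine ⟨V, h, hxV, ?_⟩
  have hXV := restrict_mem_characteristicSet hX h
  rw [hN] at hXV ⊢
  rw [Vec.restrict_part]
  exact hpart _ hXV a

/-- Closure under sums is read off from the local submodule, so multiadditivity of `extDerivative α`
is not needed. -/
theorem IsRegular.add_mem {α : M.Cochain ⊤ k} (hreg : IsRegular α) (hα : IsNatural α)
    {X Y : M.Vec U} (hX : X ∈ characteristicSet α U) (hY : Y ∈ characteristicSet α U) :
    X + Y ∈ characteristicSet α U := by
  refine mem_characteristicSet_of_locally hα fun x hx => ?_
  obtain ⟨V, h, hxV, N, hN, -⟩ := hreg.exists_submodule hx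
  refine ⟨V, h, hxV, ?_⟩
  have hXV := restrict_mem_characteristicSet hX h
  have hYV := restrict_mem_characteristicSet hY h
  rw [hN] at hXV hYV ⊢
  exact N.add_mem hXV hYV

theorem IsRegular.zero_mem {α : M.Cochain ⊤ k} (hreg : IsRegular α) (hα : IsNatural α) :
    (0 : M.Vec U) ∈ characteristicSet α U := by
  refine mem_characteristicSet_of_locally hα fun x hx => ?_
  obtain ⟨V, h, hxV, N, hN, -⟩ := hreg.exists_submodule hx
  exact ⟨V, h, hxV, hN ▸ N.zero_mem⟩

/-- The vector fields annihilated by a regular form and its differential, as a submonoid. -/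
def IsRegular.addSubmonoid {α : M.Cochain ⊤ k} (hreg : IsRegular α) (hα : IsNatural α)
    (U : Opens M.body) : AddSubmonoid (M.Vec U) where
  carrier := characteristicSet α U
  add_mem' := hreg.add_mem hα
  zero_mem' := hreg.zero_mem hα

/-! ### Cartan's formula on the kernel of the form. -/

theorem sum_fin_cons {A N : Type*} [Fintype A] [AddCommMonoid N] (F : (Fin (k + 1) → A) → N) :
    ∑ s, F s = ∑ a, ∑ t : Fin k → A, F (Fin.cons a t) := by
  rw [← Equiv.sum_comp (Fin.consEquiv fun _ => A), Fintype.sum_prod_type]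
  rfl

/-- In the Koszul formula, the terms in which `X` itself differentiates or is bracketed form the Lie
derivative. All others keep a part of `X` in the first slot of `α` and vanish. The hypothesis
concerns each part because the formula is expanded over homogeneous components. -/
theorem extDerivative_cons {α : M.Cochain ⊤ k} {X : M.Vec U}
    (hX : ∀ a, IsKilledBy (X.part a) α) (V : Opens M.body) (h : V ≤ U) (Z : Fin k → M.Vec V) :
    extDerivative α ⟨V, le_top⟩ (Fin.cons (X.restrict h) Z) =
      lieDerivative X (α.restrict le_top) ⟨V, h⟩ Z := by
  rw [lieDerivative_apply, extDerivative, sum_fin_cons]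
  refine Finset.sum_congr rfl fun a _ => Finset.sum_congr rfl fun s _ => ?_
  have hp : (fun l => (Fin.cons (X.restrict h) Z : Fin (k + 1) → M.Vec V) l |>.part
      ((Fin.cons a s : Fin (k + 1) → ZMod 2) l)) =
      Fin.cons ((X.restrict h).part a) fun i => (Z i).part (s i) := by
    funext l
    cases l using Fin.cases <;> rfl
  -- Omitting a slot `i.succ` leaves slot `0` in place; the existence of `i` forces `0 < k`.
  have hkill : ∀ (i : Fin k) (Y : Fin (k + 1) → M.Vec V), Y 0 = (X.restrict h).part a →
      α ⟨V, le_top⟩ (i.succ.removeNth Y) = 0 := by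
    intro i Y hY
    have hk : 0 < k := i.pos
    refine hX a V h _ hk ?_
    rw [Vec.restrict_part, ← hY]
    obtain ⟨k, rfl⟩ : ∃ m, k = m + 1 := ⟨k - 1, by omega⟩
    rw [Fin.removeNth_apply, Fin.zero_eta, Fin.succ_succAbove_zero]
  rw [Fin.sum_univ_succ, Finset.sum_eq_zero (s := Finset.univ), add_zero]
  · simp only [hp, Fin.removeNth_zero]
    rw [Fin.Ioi_zero_eq_map]
    simp only [Finset.sum_map, Fin.coe_succEmb, ← Fin.map_succEmb_Iic, Fin.cons_succ, Fin.cons_zero,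
      Fin.tail_cons, lieTerm, Fin.val_zero, pow_zero, one_smul, ← Fin.cons_update]
    rfl
  · intro i _
    simp only [hp]
    rw [hkill i _ rfl, Vec.app_zero, smul_zero, zero_sub, Finset.sum_eq_zero, neg_zero, smul_zero]
    intro j hj
    rw [hkill i, smul_zero]
    rw [Function.update_of_ne, Fin.cons_zero]
    -- The bracket sits at some `j > i.succ`, so it never overwrites slot `0`.
    exact (Fin.pos_of_ne_zero (fun h0 => by simp [h0] at hj)).ne


theorem IsRegular.lieDerivative_eq_zero {α : M.Cochain ⊤ k} (hreg : IsRegular α)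
    (hα : IsNatural α) {X : M.Vec U} (hX : X ∈ characteristicSet α U) :
    lieDerivative X (α.restrict le_top) = 0 := by
  funext V Z
  rw [← extDerivative_cons (fun a => (mem_characteristicSet.1 (hreg.part_mem hα hX a)).1) V.1 V.2 Z]
  exact (mem_characteristicSet.1 hX).2 V.1 V.2 _ k.succ_pos rfl

/-! ### Brackets of characteristic vector fields. -/

theorem lieTerm_eq_zero_of_lieDerivative {α : M.Cochain ⊤ k} (hα : IsForm α) {X : M.Vec U}
    {a : ZMod 2} (hX : X.IsHom a) (hL : lieDerivative X (α.restrict le_top) = 0) (h : V ≤ U)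
    {s : Fin k → ZMod 2} {Z : Fin k → M.Vec V} (hZ : ∀ i, (Z i).IsHom (s i)) :
    lieTerm (α ⟨V, le_top⟩) a (X.restrict h) s Z = 0 := by
  rw [← sum_lieTerm_of_isHom (hα.isMultiAdditive _) (hX.restrict h) hZ]
  exact congrFun (congrFun hL ⟨V, h⟩) Z

theorem IsForm.isKilledBy_zero {α : M.Cochain ⊤ k} (hα : IsForm α) :
    IsKilledBy (0 : M.Vec U) α :=
  fun _ _ _ _ hZ => (hα.isMultiAdditive _).eq_zero_of_coord _ hZ

/-- With `Y` in the first slot, the only term of `L_X α` not killed by `Y` is the one bracketing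
that slot, namely `α(⁅X, Y⁆, …)` up to sign. -/
theorem IsKilledBy.bracket {α : M.Cochain ⊤ k} (hα : IsForm α) {X Y : M.Vec U} {a b : ZMod 2}
    (hX : X.IsHom a) (hY : Y.IsHom b) (hL : lieDerivative X (α.restrict le_top) = 0)
    (hYα : IsKilledBy Y α) : IsKilledBy ⁅X, Y⁆ α := by
  intro V h Z hk hZ
  have hadd := hα.isMultiAdditive ⟨V, le_top⟩
  rw [hadd.eq_sum_part]
  refine Finset.sum_eq_zero fun s _ => ?_
  have hXY := (hX.bracket hY).restrict h
  by_cases hs : a + b = s ⟨0, hk⟩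
  swap
  · refine hadd.eq_zero_of_coord ⟨0, hk⟩ ?_
    rw [hZ, hXY.part_of_ne hs]
  set Z' : Fin k → M.Vec V := fun i => (Z i).part (s i)
  have hZ' : ∀ i, (Z' i).IsHom (s i) := fun i => Vec.isHom_part _ _
  have h0 : Z' ⟨0, hk⟩ = ⁅X.restrict h, Y.restrict h⁆ := by
    rw [← Vec.restrict_bracket]
    change (Z _).part _ = _
    rw [hZ, ← hs, ← hXY]
  -- The Lie derivative is evaluated with `⁅X, Y⁆` in slot `0` replaced by `Y`, and its parity by
  -- `b`.
  have key := lieTerm_eq_zero_of_lieDerivative hα hX hL h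
    (isHom_update hZ' ⟨0, hk⟩ (hY.restrict h))
  rw [lieTerm, hYα V h _ hk (Function.update_self _ _ _), Vec.app_zero, smul_zero, zero_sub,
    neg_eq_zero, Finset.sum_eq_single ⟨0, hk⟩] at key
  · rw [Function.update_self, Function.update_idem, ← h0, Function.update_eq_self] at key
    -- The remaining sign squares to `1`, so multiplying by it again removes it.
    have := congrArg (fun f => koszulSign
      (a * ∑ l ∈ Finset.Iic (⟨0, hk⟩ : Fin k), Function.update s ⟨0, hk⟩ b l) • f) key
    simpa only [smul_smul, koszulSign_mul_self, one_smul, smul_zero] using this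
  · intro j _ hj
    rw [hYα V h _ hk, smul_zero]
    rw [Function.update_of_ne (Ne.symm hj), Function.update_self]
  · simp

/-- Once `⁅X, Y⁆` is known to kill `α`, Cartan's formula applies to it and leaves only `L_[X,Y] α =
0` to check. -/
theorem bracket_mem_characteristicSet {α : M.Cochain ⊤ k} (hα : IsForm α) {X Y : M.Vec U}
    {a b : ZMod 2} (hX : X.IsHom a) (hY : Y.IsHom b)
    (hLX : lieDerivative X (α.restrict le_top) = 0)
    (hLY : lieDerivative Y (α.restrict le_top) = 0)
    (hYα : IsKilledBy Y α) : ⁅X, Y⁆ ∈ characteristicSet α U := by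
  have hXY := hX.bracket hY
  have hkill := IsKilledBy.bracket hα hX hY hLX hYα
  refine mem_characteristicSet.2 ⟨hkill, fun V h Z hk hZ => ?_⟩
  have hparts : ∀ c, IsKilledBy (⁅X, Y⁆.part c) α := by
    intro c
    by_cases hc : a + b = c
    · subst hc
      rwa [← hXY]
    · rw [hXY.part_of_ne hc]
      exact hα.isKilledBy_zero
  have hadd := hα.isMultiAdditive ⟨V, le_top⟩
  rw [← Fin.cons_self_tail Z, ← Fin.zero_eta, hZ, extDerivative_cons hparts, lieDerivative_apply]
  refine Finset.sum_eq_zero fun c _ => Finset.sum_eq_zero fun s _ => ?_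
  by_cases hc : a + b = c
  · subst hc
    rw [← Vec.restrict_part, ← hXY, Vec.restrict_bracket]
    exact lieTerm_bracket_eq_zero hadd (hX.restrict h) (hY.restrict h)
      (fun _ _ => lieTerm_eq_zero_of_lieDerivative hα hX hLX h)
      (fun _ _ => lieTerm_eq_zero_of_lieDerivative hα hY hLY h) fun _ => Vec.isHom_part _ _
  · rw [(hXY.restrict h).part_of_ne hc]
    exact lieTerm_zero_left hadd _ _ _

theorem IsRegular.isInvolutive {α : M.Cochain ⊤ k} (hreg : IsRegular α) (hα : IsForm α) :
    IsInvolutive (characteristicSet α) := by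
  intro U X Y hX hY
  rw [Vec.bracket_eq_sum_part]
  refine (hreg.addSubmonoid hα.natural U).sum_mem fun a _ =>
    (hreg.addSubmonoid hα.natural U).sum_mem fun b _ => ?_
  have hXa := hreg.part_mem hα.natural hX a
  have hYb := hreg.part_mem hα.natural hY b
  exact bracket_mem_characteristicSet hα (X.isHom_part a) (Y.isHom_part b)
    (hreg.lieDerivative_eq_zero hα.natural hXa) (hreg.lieDerivative_eq_zero hα.natural hYb)
    (mem_characteristicSet.1 hYb).1

end Supermanifold


theorem mainTheorem5 {p q : ℕ} (M : Supermanifold.{u} p q) {k : ℕ}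
    (α : M.Cochain ⊤ k) (hα : Supermanifold.IsForm α) (hreg : Supermanifold.IsRegular α) :
    Supermanifold.IsInvolutive (Supermanifold.characteristicSet α) ∧
      ∀ (U : TopologicalSpace.Opens M.body) (X : M.Vec U),
        X ∈ Supermanifold.characteristicSet α U →
          Supermanifold.lieDerivative X (α.restrict le_top) = 0 :=
  ⟨hreg.isInvolutive hα, fun _ _ hX => hreg.lieDerivative_eq_zero hα.natural hX⟩
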